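/- For $\alpha>0$ and a weight vector $\theta=(\theta_1,\dots,\theta_n)$ with nonnegative components, let $F_\theta$ denote the distribution function of $\sum_{i=1}^n\theta_iX_i$, where $X_1,\dots,X_n$ are independent gamma$(\alpha,1)$ random variables. Write $\eta\prec\theta$ if $\theta$ majorizes $\eta$: for each $k\le n$ the sum of the $k$ largest components of $\eta$ is at most the sum of the $k$ largest components of $\theta$, and $\sum_i\eta_i=\sum_i\theta_i$. A function $f$ changes signs at least $k$ times on $(0,\infty)$ if there are $0<x_0<x_1<\dots<x_k$ such that $f(x_0),\dots,f(x_k)$ are nonzero and of alternating signs. The unique crossing conjecture for $(\alpha,n)$ asserts that, for all nonnegative $\theta,\eta\in\mathbb{R}^n$ such that $\eta\prec\theta$ and $\theta$ is not a permutation of $\eta$, the function $F_\eta-F_\theta$ changes signs exactly once on $(0,\infty)$, from $-$ to $+$. Theorem. Let $0<\alpha<1$. (1) There exist vectors $\theta,\eta\in\mathbb{R}^3$ with positive components such that $\eta\prec\theta$ and $F_\eta-F_\theta$ changes signs at least three times on $(0,\infty)$. (2) If $\theta,\eta\in\mathbb{R}^3$ are any vectors as in (1), then for every $m\ge 0$ there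 is $\varepsilon>0$ such that for all $c_1,\dots,c_m\in(0,\varepsilon)$ the vectors $\theta'=(\theta_1,\theta_2,\theta_3,c_1,\dots,c_m)$ and $\eta'=(\eta_1,\eta_2,\eta_3,c_1,\dots,c_m)$ satisfy $\eta'\prec\theta'$, and $F_{\eta'}-F_{\theta'}$ changes signs at least three times on $(0,\infty)$. (3) Consequently, the unique crossing conjecture for $(\alpha,n)$ is false for every $n\ge 3$. -/

import Mathlib

open MeasureTheory ProbabilityTheory

namespace UniqueCrossing

/-- The distribution function `F_θ` of `∑ i, θ i * X i`, where the `X i` are iid gamma(`α`, 1)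
random variables, realized as the coordinates of the product of `n` gamma measures. -/
noncomputable def F {n : ℕ} (α : ℝ) (θ : Fin n → ℝ) (x : ℝ) : ℝ :=
  cdf ((Measure.pi fun _ : Fin n => gammaMeasure α 1).map
    fun X : Fin n → ℝ => ∑ i, θ i * X i) x

/-- The components of `θ` rearranged in decreasing order. -/
noncomputable def decr {n : ℕ} (θ : Fin n → ℝ) (i : Fin n) : ℝ :=
  θ (Tuple.sort θ i.rev)

/-- `MajorizedBy η θ` is the majorization order `η ≺ θ`: for each `k` the sum of the `k` largest
components of `η` is at most that of `θ`, and the sums of all components agree. -/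
def MajorizedBy {n : ℕ} (η θ : Fin n → ℝ) : Prop :=
  (∀ k : ℕ, k ≤ n → ∑ i : Fin n with i.val < k, decr η i ≤ ∑ i : Fin n with i.val < k, decr θ i) ∧
    ∑ i, η i = ∑ i, θ i

/-- `f` changes signs at least `k` times on `(0, ∞)`: there are `k + 1` increasing points at which
`f` is nonzero, with opposite signs at consecutive points. -/
def ChangesSignAtLeast (k : ℕ) (f : ℝ → ℝ) : Prop :=
  ∃ x : Fin (k + 1) → ℝ, StrictMono x ∧ (∀ i, 0 < x i) ∧ (∀ i, f (x i) ≠ 0) ∧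
    ∀ i : Fin k, f (x i.castSucc) * f (x i.succ) < 0

/-- `f` changes signs exactly once on `(0, ∞)`, from `-` to `+`. -/
def ChangesSignOnceUp (f : ℝ → ℝ) : Prop :=
  ChangesSignAtLeast 1 f ∧ ¬ ChangesSignAtLeast 2 f ∧
    ∀ x y : ℝ, 0 < x → x < y → f x * f y < 0 → f x < 0 ∧ 0 < f y

/-- The unique crossing conjecture for shape parameter `α` and weight vectors of length `n`. -/
def UCC (α : ℝ) (n : ℕ) : Prop :=
  ∀ θ η : Fin n → ℝ, (∀ i, 0 ≤ θ i) → (∀ i, 0 ≤ η i) → MajorizedBy η θ →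
    (¬ ∃ σ : Equiv.Perm (Fin n), θ = η ∘ σ) →
    ChangesSignOnceUp fun x => F α η x - F α θ x

end UniqueCrossing

/-!
The counterexample is asymptotic. Write `G` and `g` for the distribution function and the density of
the gamma(`α`, 1) law. For a small parameter `b`, compare `η = (1, b, b)` with
`θ = (1 / (1 - q), 2 b - q / (1 - q), 0)`, where `q = K b ^ 2` and `K = 4 / α`. Conditioning on all
variables but the first gives `F_η x = E G (x - W)` with `W` of order `b`, and similarly for `θ`.
A second-order Taylor expansion of `G` at a fixed `x > 0`, with a cubic error bound that is global
in `W ≥ 0`, yields (`tendsto_F_sub_F`)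

`(F_η x - F_θ x) / b ^ 2 → g x * (α * (1 + (1 - α) / x) - K * (α - x))`.

The first term in the bracket comes from splitting `(2 b, 0)` into `(b, b)`: it is positive since `g`
is decreasing for `α < 1`, and it blows up at `0`. The second comes from taking mass away from the
first weight, and is negative below `α`. The limit is therefore positive at `α (1 - α) / 4`, negative
at `α / 2` and positive at `2 α`. Once `b` is fixed, `F_η x` is of order `x ^ (3 α)` and `F_θ x` of
order `x ^ (2 α)` as `x → 0`, so the difference is negative near `0` (`eventually_F_lt_F`), and the
signs `-, +, -, +` occur (`exists_three_sign_changes_boundary`).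

The zero weight is removed by adding a small constant to all weights: this keeps majorization, and
keeps the four strict inequalities because `F` is continuous in the weights as long as one of them is
nonzero (`continuousAt_F`, which rests on hyperplanes being null). The same continuity at zero
appended weights gives the stability under appending small weights. Weight vectors that are
permutations of each other have the same `F`, so the resulting pairs refute the conjecture in every
dimension at least three.
-/

namespace UniqueCrossing

open Set Filter Topology

/-! ### The gamma distribution: moments, power bounds and Taylor expansion -/

lemma gammaPDFReal_one_of_pos {α x : ℝ} (hx : 0 < x) :
    gammaPDFReal α 1 x = (Real.Gamma α)⁻¹ * x ^ (α - 1) * Real.exp (-x) := by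
  simp [gammaPDFReal, hx.le]

lemma gammaPDFReal_mul_pow_ae (α : ℝ) (k : ℕ) :
    (fun x => gammaPDFReal α 1 x * x ^ k) =ᵐ[volume]
      (Ioi 0).indicator fun x => (Real.Gamma α)⁻¹ * (Real.exp (-x) * x ^ (α + k - 1)) := by
  filter_upwards [compl_mem_ae_iff.2 (measure_singleton (0 : ℝ))] with x hx
  rcases lt_trichotomy x 0 with h | h | h
  · simp [gammaPDFReal, h.not_ge, h.le]
  · exact absurd h hx
  · rw [indicator_of_mem (mem_Ioi.2 h), gammaPDFReal_one_of_pos h,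
      show α + k - 1 = (α - 1) + k by ring, Real.rpow_add h, Real.rpow_natCast]
    ring

lemma integrable_gammaPDFReal_mul_pow {α : ℝ} (hα : 0 < α) (k : ℕ) :
    Integrable (fun x => gammaPDFReal α 1 x * x ^ k) := by
  rw [integrable_congr (gammaPDFReal_mul_pow_ae α k), integrable_indicator_iff measurableSet_Ioi]
  exact (Real.GammaIntegral_convergent (by positivity : 0 < α + k)).const_mul _

lemma integrable_gammaPDFReal {α : ℝ} (hα : 0 < α) : Integrable (gammaPDFReal α 1) := by
  simpa using integrable_gammaPDFReal_mul_pow hα 0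

lemma integrable_pow_gammaMeasure {α : ℝ} (hα : 0 < α) (k : ℕ) :
    Integrable (fun x : ℝ => x ^ k) (gammaMeasure α 1) := by
  unfold gammaMeasure gammaPDF
  rw [integrable_withDensity_iff_integrable_smul' (by fun_prop) (by simp)]
  simpa [ENNReal.toReal_ofReal (gammaPDFReal_nonneg hα one_pos _)] using
    integrable_gammaPDFReal_mul_pow hα k

lemma integral_pow_gammaMeasure {α : ℝ} (hα : 0 < α) (k : ℕ) :
    ∫ x, x ^ k ∂gammaMeasure α 1 = (Real.Gamma α)⁻¹ * Real.Gamma (α + k) := by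
  unfold gammaMeasure gammaPDF
  rw [integral_withDensity_eq_integral_toReal_smul (by fun_prop) (by simp)]
  simp only [ENNReal.toReal_ofReal (gammaPDFReal_nonneg hα one_pos _), smul_eq_mul]
  rw [integral_congr_ae (gammaPDFReal_mul_pow_ae α k), integral_indicator measurableSet_Ioi,
    integral_const_mul,
    Real.Gamma_eq_integral (by positivity : 0 < α + k)]

lemma integral_id_gammaMeasure {α : ℝ} (hα : 0 < α) : ∫ x, x ∂gammaMeasure α 1 = α := by
  have := integral_pow_gammaMeasure hα 1
  simp only [pow_one, Nat.cast_one] at this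
  rw [this, Real.Gamma_add_one hα.ne']
  field_simp [(Real.Gamma_pos_of_pos hα).ne']

lemma integral_sq_gammaMeasure {α : ℝ} (hα : 0 < α) :
    ∫ x, x ^ 2 ∂gammaMeasure α 1 = α * (α + 1) := by
  rw [integral_pow_gammaMeasure hα 2, show α + ((2 : ℕ) : ℝ) = (α + 1) + 1 by push_cast; ring,
    Real.Gamma_add_one (by positivity), Real.Gamma_add_one hα.ne']
  field_simp [(Real.Gamma_pos_of_pos hα).ne']

instance nullSingletonClass_gammaMeasure (α : ℝ) : NullSingletonClass (gammaMeasure α 1) := by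
  unfold gammaMeasure; infer_instance

lemma ae_nonneg_gammaMeasure (α : ℝ) : ∀ᵐ x ∂gammaMeasure α 1, 0 ≤ x := by
  rw [ae_iff, gammaMeasure]
  have : {a : ℝ | ¬ 0 ≤ a} = Iio 0 := by ext; simp
  rw [this, withDensity_apply _ measurableSet_Iio]
  exact lintegral_gammaPDF_of_nonpos le_rfl

lemma cdf_gamma_eq_intervalIntegral {α : ℝ} (hα : 0 < α) (y : ℝ) :
    cdf (gammaMeasure α 1) y = ∫ x in (0 : ℝ)..y, gammaPDFReal α 1 x := by
  have h := intervalIntegral.integral_Iic_sub_Iic (μ := volume) (a := 0) (b := y)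
    (integrable_gammaPDFReal hα).integrableOn (integrable_gammaPDFReal hα).integrableOn
  have h0 : ∫ x in Iic (0 : ℝ), gammaPDFReal α 1 x = 0 := by
    rw [integral_Iic_eq_integral_Iio, setIntegral_congr_fun (g := fun _ => 0) measurableSet_Iio]
    · simp
    · intro x hx
      simp [gammaPDFReal, (mem_Iio.1 hx).not_ge]
  rw [cdf_gammaMeasure_eq_integral hα one_pos, ← h, h0, sub_zero]

/-- The crude upper bound `cdf y ≤ y ^ α / (α Γ(α))`, sharp as `y → 0`. -/
lemma cdf_gamma_le {α : ℝ} (hα : 0 < α) {y : ℝ} (hy : 0 < y) :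
    cdf (gammaMeasure α 1) y ≤ (Real.Gamma α)⁻¹ * (y ^ α / α) := by
  have hΓ := Real.Gamma_pos_of_pos hα
  have hint : IntervalIntegrable (fun x : ℝ => x ^ (α - 1)) volume 0 y :=
    intervalIntegral.intervalIntegrable_rpow' (by linarith)
  have e : ∫ x in (0 : ℝ)..y, (Real.Gamma α)⁻¹ * x ^ (α - 1) = (Real.Gamma α)⁻¹ * (y ^ α / α) := by
    rw [intervalIntegral.integral_const_mul, integral_rpow (Or.inl (by linarith))]
    simp [Real.zero_rpow hα.ne']
  rw [cdf_gamma_eq_intervalIntegral hα, ← e]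
  refine intervalIntegral.integral_mono_on_of_le_Ioo hy.le
    (integrable_gammaPDFReal hα).intervalIntegrable (hint.const_mul _) fun x hx => ?_
  rw [gammaPDFReal_one_of_pos hx.1]
  refine mul_le_of_le_one_right (by have := Real.rpow_nonneg hx.1.le (α - 1); positivity) ?_
  simpa using hx.1.le

lemma le_cdf_gamma {α : ℝ} (hα : 0 < α) {y : ℝ} (hy : 0 < y) (hy1 : y ≤ 1) :
    (Real.Gamma α)⁻¹ * (y ^ α / α) * Real.exp (-1) ≤ cdf (gammaMeasure α 1) y := by
  have hΓ := Real.Gamma_pos_of_pos hα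
  have hint : IntervalIntegrable (fun x : ℝ => x ^ (α - 1)) volume 0 y :=
    intervalIntegral.intervalIntegrable_rpow' (by linarith)
  have e : ∫ x in (0 : ℝ)..y, (Real.Gamma α)⁻¹ * x ^ (α - 1) * Real.exp (-1)
      = (Real.Gamma α)⁻¹ * (y ^ α / α) * Real.exp (-1) := by
    rw [intervalIntegral.integral_mul_const, intervalIntegral.integral_const_mul,
      integral_rpow (Or.inl (by linarith))]
    simp [Real.zero_rpow hα.ne']
  rw [cdf_gamma_eq_intervalIntegral hα, ← e]
  refine intervalIntegral.integral_mono_on_of_le_Ioo hy.le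
    ((hint.const_mul _).mul_const _) (integrable_gammaPDFReal hα).intervalIntegrable fun x hx => ?_
  rw [gammaPDFReal_one_of_pos hx.1]
  have := Real.rpow_nonneg hx.1.le (α - 1)
  gcongr
  linarith [hx.2]

lemma hasDerivAt_cdf_gamma {α : ℝ} (hα : 0 < α) {x : ℝ} (hx : 0 < x) :
    HasDerivAt (fun y => (cdf (gammaMeasure α 1) y : ℝ))
      ((Real.Gamma α)⁻¹ * x ^ (α - 1) * Real.exp (-x)) x := by
  have hpdf : gammaPDFReal α 1 =ᶠ[𝓝 x]
      fun y => (Real.Gamma α)⁻¹ * y ^ (α - 1) * Real.exp (-y) := by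
    filter_upwards [Ioi_mem_nhds hx] with y hy using gammaPDFReal_one_of_pos hy
  have hc : ContinuousAt (gammaPDFReal α 1) x := by
    refine ContinuousAt.congr ?_ hpdf.symm
    exact (continuousAt_const.mul (Real.continuousAt_rpow_const _ _ (Or.inl hx.ne'))).mul
      (by fun_prop)
  have h := intervalIntegral.integral_hasDerivAt_right
    ((integrable_gammaPDFReal hα).intervalIntegrable (a := 0) (b := x))
    (stronglyMeasurable_gammaPDFReal α 1).stronglyMeasurableAtFilter hc
  rw [gammaPDFReal_one_of_pos hx] at h
  refine h.congr_of_eventuallyEq ?_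
  filter_upwards [Ioi_mem_nhds hx] with y _ using cdf_gamma_eq_intervalIntegral hα y

lemma hasDerivAt_gamma_density (α : ℝ) {x : ℝ} (hx : 0 < x) :
    HasDerivAt (fun y => (Real.Gamma α)⁻¹ * y ^ (α - 1) * Real.exp (-y))
      ((Real.Gamma α)⁻¹ * x ^ (α - 1) * Real.exp (-x) * ((α - 1) / x - 1)) x := by
  have h := ((Real.hasDerivAt_rpow_const (p := α - 1) (Or.inl hx.ne')).const_mul
    (Real.Gamma α)⁻¹).mul (hasDerivAt_neg x).exp
  refine h.congr_deriv ?_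
  rw [Real.rpow_sub_one hx.ne' (α - 1)]
  field_simp
  ring

/-- Integrating a bound `|f'| ≤ C w ^ k` from `0`, with a constant that is not sharp. -/
lemma abs_le_of_hasDerivAt_pow {f f' : ℝ → ℝ} {C δ : ℝ} (hC : 0 ≤ C) {k : ℕ}
    (hf : ∀ w ∈ Icc 0 δ, HasDerivAt f (f' w) w) (h0 : f 0 = 0)
    (hb : ∀ w ∈ Icc 0 δ, |f' w| ≤ C * w ^ k) :
    ∀ w ∈ Icc 0 δ, |f w| ≤ C * w ^ (k + 1) := by
  intro w hw
  have := (convex_Icc (0 : ℝ) w).norm_image_sub_le_of_norm_hasDerivWithin_le (f := f) (f' := f')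
    (C := C * w ^ k) (fun u hu => (hf u ⟨hu.1, hu.2.trans hw.2⟩).hasDerivWithinAt)
    (fun u hu => (hb u ⟨hu.1, hu.2.trans hw.2⟩).trans
      (mul_le_mul_of_nonneg_left (pow_le_pow_left₀ hu.1 hu.2 k) hC))
    (left_mem_Icc.2 hw.1) (right_mem_Icc.2 hw.1)
  simpa [h0, abs_of_nonneg hw.1, pow_succ, mul_assoc] using this

/-- Second-order Taylor expansion of the gamma distribution function to the left of `x`. The
cubic error bound holds for all `w ≥ 0`, also where `x - w` is negative, as the distribution
function is bounded. -/
lemma exists_cdf_gamma_taylor {α : ℝ} (hα : 0 < α) {x : ℝ} (hx : 0 < x) :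
    ∃ C, ∀ w, 0 ≤ w → |cdf (gammaMeasure α 1) (x - w) - (cdf (gammaMeasure α 1) x
      - (Real.Gamma α)⁻¹ * x ^ (α - 1) * Real.exp (-x) * w
      + (Real.Gamma α)⁻¹ * x ^ (α - 1) * Real.exp (-x) * ((α - 1) / x - 1) / 2 * w ^ 2)|
        ≤ C * w ^ 3 := by
  set g : ℝ → ℝ := fun y => (Real.Gamma α)⁻¹ * y ^ (α - 1) * Real.exp (-y) with hg
  set g1 : ℝ → ℝ := fun y => g y * ((α - 1) / y - 1) with hg1
  set g2 : ℝ → ℝ := fun y => g1 y * ((α - 1) / y - 1) + g y * (-(α - 1) / y ^ 2) with hg2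
  set G : ℝ → ℝ := fun y => cdf (gammaMeasure α 1) y with hG
  have dG : ∀ y, 0 < y → HasDerivAt G (g y) y := fun y hy => hasDerivAt_cdf_gamma hα hy
  have dg : ∀ y, 0 < y → HasDerivAt g (g1 y) y := fun y hy => hasDerivAt_gamma_density α hy
  have dg1 : ∀ y, 0 < y → HasDerivAt g1 (g2 y) y := by
    intro y hy
    have h1 : HasDerivAt (fun y : ℝ => (α - 1) / y - 1) (-(α - 1) / y ^ 2) y := by
      have := ((hasDerivAt_inv hy.ne').const_mul (α - 1)).sub_const 1
      simp only [div_eq_mul_inv]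
      exact this.congr_deriv (by ring)
    exact (dg y hy).mul h1
  have cg2 : ContinuousOn g2 (Icc (x / 2) x) := by
    intro y hy
    have hy0 : 0 < y := by linarith [hy.1]
    have c1 := (dg y hy0).continuousAt
    have c2 := (dg1 y hy0).continuousAt
    have c3 : ContinuousAt (fun y : ℝ => (α - 1) / y - 1) y :=
      (continuousAt_const.div continuousAt_id hy0.ne').sub continuousAt_const
    have c4 : ContinuousAt (fun y : ℝ => -(α - 1) / y ^ 2) y :=
      continuousAt_const.div (by fun_prop) (by positivity)
    exact ((c2.mul c3).add (c1.mul c4)).continuousWithinAt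
  obtain ⟨C, hC⟩ := isCompact_Icc.exists_bound_of_continuousOn cg2
  have hC0 : 0 ≤ C := (norm_nonneg _).trans (hC x ⟨by linarith, le_rfl⟩)
  have pos : ∀ w ∈ Icc 0 (x / 2), 0 < x - w := fun w hw => by linarith [hw.2]
  have dsub : ∀ w : ℝ, HasDerivAt (fun w => x - w) (-1) w := fun w => by
    simpa using (hasDerivAt_id w).const_sub x
  have near2 : ∀ w ∈ Icc 0 (x / 2), |g1 (x - w) - g1 x| ≤ C * w ^ (0 + 1) :=
    abs_le_of_hasDerivAt_pow (f' := fun w => g2 (x - w) * (-1)) hC0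
      (fun w hw => ((dg1 _ (pos w hw)).comp w (dsub w)).sub_const _) (by simp)
      (fun w hw => by
        simpa using hC (x - w) ⟨by linarith [hw.2], by linarith [hw.1]⟩)
  have near1 : ∀ w ∈ Icc 0 (x / 2), |g (x - w) - g x + g1 x * w| ≤ C * w ^ (0 + 1 + 1) :=
    abs_le_of_hasDerivAt_pow (f' := fun w => g1 (x - w) * (-1) + g1 x * 1) hC0
      (fun w hw => (((dg _ (pos w hw)).comp w (dsub w)).sub_const _).add
        ((hasDerivAt_id w).const_mul _)) (by simp)
      (fun w hw => by
        rw [show g1 (x - w) * (-1) + g1 x * 1 = -(g1 (x - w) - g1 x) by ring, abs_neg]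
        exact near2 w hw)
  have near : ∀ w ∈ Icc 0 (x / 2), |G (x - w) - (G x - g x * w + g1 x / 2 * w ^ 2)|
      ≤ C * w ^ (0 + 1 + 1 + 1) :=
    abs_le_of_hasDerivAt_pow
      (f' := fun w => g (x - w) * (-1) - (0 - g x * 1 + g1 x / 2 * (2 * w))) hC0
      (fun w hw => ((dG _ (pos w hw)).comp w (dsub w)).sub
        ((((hasDerivAt_const w (G x)).sub ((hasDerivAt_id w).const_mul _))).add
          (by simpa using (hasDerivAt_pow 2 w).const_mul (g1 x / 2)))) (by simp)
      (fun w hw => by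
        rw [show g (x - w) * (-1) - (0 - g x * 1 + g1 x / 2 * (2 * w))
          = -(g (x - w) - g x + g1 x * w) by ring, abs_neg]
        exact near1 w hw)
  refine ⟨C + (2 / x) ^ 3 + |g x| * (2 / x) ^ 2 + |g1 x / 2| * (2 / x), fun w hw => ?_⟩
  have hA : (0 : ℝ) ≤ (2 / x) ^ 3 + |g x| * (2 / x) ^ 2 + |g1 x / 2| * (2 / x) := by positivity
  have hw3 : (0 : ℝ) ≤ w ^ 3 := by positivity
  rcases le_or_gt w (x / 2) with h | h
  · have := near w ⟨hw, h⟩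
    simp only [Nat.reduceAdd] at this
    refine this.trans (mul_le_mul_of_nonneg_right ?_ hw3)
    linarith
  · -- here `1 ≤ 2 w / x`, so every power of `w` below the third is absorbed into `w ^ 3`
    set t := 2 / x * w with ht
    have ht1 : 1 ≤ t := by
      rw [ht, div_mul_eq_mul_div, le_div_iff₀ hx]; linarith
    have hGG : |G (x - w) - G x| ≤ 1 := by
      have a1 := cdf_nonneg (gammaMeasure α 1) (x - w)
      have a2 := cdf_le_one (gammaMeasure α 1) (x - w)
      have a3 := cdf_nonneg (gammaMeasure α 1) x
      have a4 := cdf_le_one (gammaMeasure α 1) x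
      rw [abs_le]; constructor <;> simp only [hG] <;> linarith
    have t2 : 1 ≤ t ^ 2 := one_le_pow₀ ht1
    have t3 : 1 ≤ t ^ 3 := one_le_pow₀ ht1
    calc |G (x - w) - (G x - g x * w + g1 x / 2 * w ^ 2)|
        = |(G (x - w) - G x) + g x * w + (-(g1 x / 2 * w ^ 2))| := by congr 1; ring
      _ ≤ |G (x - w) - G x| + |g x * w| + |-(g1 x / 2 * w ^ 2)| := abs_add_three _ _ _
      _ ≤ 1 + |g x| * w + |g1 x / 2| * w ^ 2 := by
          rw [abs_neg, abs_mul (g x), abs_mul (g1 x / 2), abs_of_nonneg hw,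
            abs_of_nonneg (sq_nonneg w)]
          linarith
      _ ≤ t ^ 3 + |g x| * w * t ^ 2 + |g1 x / 2| * w ^ 2 * t := by
          have b1 : |g x| * w * 1 ≤ |g x| * w * t ^ 2 :=
            mul_le_mul_of_nonneg_left t2 (by positivity)
          have b2 : |g1 x / 2| * w ^ 2 * 1 ≤ |g1 x / 2| * w ^ 2 * t :=
            mul_le_mul_of_nonneg_left ht1 (by positivity)
          linarith
      _ = ((2 / x) ^ 3 + |g x| * (2 / x) ^ 2 + |g1 x / 2| * (2 / x)) * w ^ 3 := by
          rw [ht]; ring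
      _ ≤ _ := mul_le_mul_of_nonneg_right (by linarith) hw3

/-! ### The distribution function of a weighted sum -/

/-- The joint law of `n` independent gamma(`α`, 1) variables. -/
noncomputable abbrev gammaPi (α : ℝ) (n : ℕ) : Measure (Fin n → ℝ) :=
  Measure.pi fun _ : Fin n => gammaMeasure α 1

lemma isProbabilityMeasure_gammaPi {α : ℝ} (hα : 0 < α) (n : ℕ) :
    IsProbabilityMeasure (gammaPi α n) := by
  have := isProbabilityMeasure_gammaMeasure hα one_pos
  infer_instance

lemma F_eq_measureReal {α : ℝ} (hα : 0 < α) {n : ℕ} (θ : Fin n → ℝ) (x : ℝ) :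
    F α θ x = (gammaPi α n).real {X | ∑ i, θ i * X i ≤ x} := by
  have := isProbabilityMeasure_gammaPi hα n
  have hm : Measurable fun X : Fin n → ℝ => ∑ i, θ i * X i := by fun_prop
  have : IsProbabilityMeasure ((gammaPi α n).map fun X : Fin n → ℝ => ∑ i, θ i * X i) :=
    Measure.isProbabilityMeasure_map hm.aemeasurable
  rw [F, cdf_eq_real, map_measureReal_apply hm measurableSet_Iic]
  rfl

/-- `F` may be computed from any `n` distinct coordinates of a longer iid family. -/
lemma F_eq_of_injective {α : ℝ} (hα : 0 < α) {n N : ℕ} {e : Fin n → Fin N}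
    (he : Function.Injective e) (θ : Fin n → ℝ) (x : ℝ) :
    F α θ x = (gammaPi α N).real {X | ∑ i, θ i * X (e i) ≤ x} := by
  have := isProbabilityMeasure_gammaMeasure hα one_pos
  have hind : iIndepFun (fun (i : Fin N) (X : Fin N → ℝ) => X i) (gammaPi α N) :=
    iIndepFun_pi (X := fun _ => id) fun _ => aemeasurable_id
  have hmap := (hind.precomp he).map_fun_eq_pi_map fun i => (measurable_pi_apply (e i)).aemeasurable
  have hcoord : ∀ i, (gammaPi α N).map (fun X => X (e i)) = gammaMeasure α 1 := fun i =>
    (measurePreserving_eval (fun _ : Fin N => gammaMeasure α 1) (e i)).map_eq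
  simp only [hcoord] at hmap
  rw [F_eq_measureReal hα, gammaPi, ← hmap,
    map_measureReal_apply (by fun_prop) (measurableSet_le (by fun_prop) measurable_const)]
  rfl

lemma F_comp_perm {α : ℝ} (hα : 0 < α) {n : ℕ} (η : Fin n → ℝ) (σ : Equiv.Perm (Fin n)) (x : ℝ) :
    F α (η ∘ σ) x = F α η x := by
  rw [F_eq_of_injective hα σ.injective, F_eq_measureReal hα η]
  congr 1
  ext X
  simp only [mem_ofPred_eq, Function.comp_apply, Equiv.sum_comp σ fun i => η i * X i]

lemma F_append_zero {α : ℝ} (hα : 0 < α) {n m : ℕ} (θ : Fin n → ℝ) (x : ℝ) :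
    F α (Fin.append θ (0 : Fin m → ℝ)) x = F α θ x := by
  rw [F_eq_of_injective hα (Fin.castAdd_injective n m), F_eq_measureReal hα]
  congr 1
  ext X
  simp [Fin.sum_univ_add]

lemma gammaPi_hyperplane {α : ℝ} (hα : 0 < α) {n : ℕ} {θ : Fin n → ℝ} {i : Fin n}
    (hi : θ i ≠ 0) (x : ℝ) : gammaPi α n {X | ∑ j, θ j * X j = x} = 0 := by
  have := isProbabilityMeasure_gammaMeasure hα one_pos
  rcases n with _ | n
  · exact i.elim0
  have hmp := measurePreserving_piFinSuccAbove (fun _ : Fin (n + 1) => gammaMeasure α 1) i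
  have hs : MeasurableSet {p : ℝ × (Fin n → ℝ) | θ i * p.1 + ∑ j, θ (i.succAbove j) * p.2 j = x} :=
    measurableSet_eq_fun (by fun_prop) measurable_const
  have hpre : {X : Fin (n + 1) → ℝ | ∑ j, θ j * X j = x} =
      MeasurableEquiv.piFinSuccAbove (fun _ : Fin (n + 1) => ℝ) i ⁻¹'
        {p : ℝ × (Fin n → ℝ) | θ i * p.1 + ∑ j, θ (i.succAbove j) * p.2 j = x} := by
    ext X
    simp [Fin.sum_univ_succAbove _ i, Fin.removeNth, MeasurableEquiv.piFinSuccAbove_apply]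
  rw [hpre, hmp.measure_preimage hs.nullMeasurableSet, Measure.prod_apply_symm hs]
  refine lintegral_eq_zero_of_ae_eq_zero (Eventually.of_forall fun Y => ?_)
  refine measure_mono_null (t := {(x - ∑ j, θ (i.succAbove j) * Y j) / θ i}) ?_
    (measure_singleton _)
  intro u hu
  have hu' : θ i * u + ∑ j, θ (i.succAbove j) * Y j = x := hu
  rw [mem_singleton_iff, eq_div_iff hi]
  linarith

lemma continuousAt_F {α : ℝ} (hα : 0 < α) {n : ℕ} {θ : Fin n → ℝ} {i : Fin n}
    (hi : θ i ≠ 0) (x : ℝ) : ContinuousAt (fun η : Fin n → ℝ => F α η x) θ := by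
  have := isProbabilityMeasure_gammaPi hα n
  have hm : ∀ η : Fin n → ℝ, MeasurableSet {X : Fin n → ℝ | ∑ i, η i * X i ≤ x} :=
    fun η => measurableSet_le (by fun_prop) measurable_const
  simp only [ContinuousAt, F_eq_measureReal hα]
  refine (ENNReal.tendsto_toReal (measure_ne_top _ _)).comp ?_
  refine tendsto_measure_of_ae_tendsto_indicator_of_isFiniteMeasure _ (hm θ) hm ?_
  have hnull : ∀ᵐ X ∂gammaPi α n, ∑ j, θ j * X j ≠ x := by
    rw [ae_iff]; simpa using gammaPi_hyperplane hα hi x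
  filter_upwards [hnull] with X hX
  have hc : ContinuousAt (fun η : Fin n → ℝ => ∑ j, η j * X j) θ :=
    (by fun_prop : Continuous fun η : Fin n → ℝ => ∑ j, η j * X j).continuousAt
  rcases lt_or_gt_of_ne hX with h | h
  · filter_upwards [hc.eventually_lt_const h] with η hη
    exact iff_of_true hη.le h.le
  · filter_upwards [hc.eventually_const_lt h] with η hη
    exact iff_of_false hη.not_ge h.not_ge

/-- Conditioning on all but the first variable. -/
lemma F_succ_eq_integral {α : ℝ} (hα : 0 < α) {n : ℕ} {θ : Fin (n + 1) → ℝ} (h0 : 0 < θ 0)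
    (x : ℝ) : F α θ x =
      ∫ Y, cdf (gammaMeasure α 1) ((x - ∑ j, θ j.succ * Y j) / θ 0) ∂gammaPi α n := by
  have := isProbabilityMeasure_gammaMeasure hα one_pos
  have hmp := measurePreserving_piFinSuccAbove (fun _ : Fin (n + 1) => gammaMeasure α 1) 0
  have hs : MeasurableSet {p : ℝ × (Fin n → ℝ) | θ 0 * p.1 + ∑ j : Fin n, θ j.succ * p.2 j ≤ x} :=
    measurableSet_le (by fun_prop) measurable_const
  have hpre : {X : Fin (n + 1) → ℝ | ∑ j, θ j * X j ≤ x} =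
      MeasurableEquiv.piFinSuccAbove (fun _ : Fin (n + 1) => ℝ) 0 ⁻¹'
        {p : ℝ × (Fin n → ℝ) | θ 0 * p.1 + ∑ j : Fin n, θ j.succ * p.2 j ≤ x} := by
    ext X
    simp [Fin.sum_univ_succ, Fin.tail, MeasurableEquiv.piFinSuccAbove_apply]
  have hslice : ∀ Y : Fin n → ℝ, (fun u : ℝ => (u, Y)) ⁻¹'
      {p : ℝ × (Fin n → ℝ) | θ 0 * p.1 + ∑ j : Fin n, θ j.succ * p.2 j ≤ x}
        = Iic ((x - ∑ j, θ j.succ * Y j) / θ 0) := by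
    intro Y
    ext u
    rw [mem_Iic, le_div_iff₀ h0]
    simp only [mem_preimage, mem_ofPred_eq]
    constructor <;> intro h <;> linarith
  rw [F_eq_measureReal hα, measureReal_def, hpre, hmp.measure_preimage hs.nullMeasurableSet,
    Measure.prod_apply_symm hs]
  simp only [hslice, cdf_eq_real, measureReal_def]
  rw [integral_toReal]
  · exact (Measurable.comp (g := fun t => gammaMeasure α 1 (Iic t))
      (Monotone.measurable fun s t hst => measure_mono (Iic_subset_Iic.2 hst))
      (by fun_prop)).aemeasurable
  · exact Eventually.of_forall fun Y => measure_lt_top _ _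

lemma ae_nonneg_gammaPi {α : ℝ} (hα : 0 < α) (n : ℕ) : ∀ᵐ X ∂gammaPi α n, ∀ i, 0 ≤ X i := by
  have := isProbabilityMeasure_gammaMeasure hα one_pos
  exact ae_all_iff.2 fun i =>
    (measurePreserving_eval (fun _ : Fin n => gammaMeasure α 1) i).quasiMeasurePreserving.ae
      (ae_nonneg_gammaMeasure α)

lemma memLp_eval_gammaPi {α : ℝ} (hα : 0 < α) {n : ℕ} (i : Fin n) (k : ℕ) :
    MemLp (fun X : Fin n → ℝ => X i) k (gammaPi α n) := by
  have := isProbabilityMeasure_gammaMeasure hα one_pos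
  have h : MemLp (fun x : ℝ => x) k (gammaMeasure α 1) := by
    rcases eq_or_ne k 0 with rfl | hk
    · simpa using measurable_id'.aestronglyMeasurable
    · rw [← integrable_norm_rpow_iff measurable_id'.aestronglyMeasurable (by simpa) (by simp)]
      simpa using (integrable_pow_gammaMeasure hα k).norm
  exact h.comp_measurePreserving
    (measurePreserving_eval (fun _ : Fin n => gammaMeasure α 1) i)

lemma integral_eval_gammaPi {α : ℝ} (hα : 0 < α) {n : ℕ} (i : Fin n) {f : ℝ → ℝ}
    (hf : Measurable f) : ∫ X, f (X i) ∂gammaPi α n = ∫ x, f x ∂gammaMeasure α 1 := by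
  have := isProbabilityMeasure_gammaMeasure hα one_pos
  rw [← (measurePreserving_eval (fun _ : Fin n => gammaMeasure α 1) i).map_eq,
    integral_map (measurable_pi_apply i).aemeasurable hf.aestronglyMeasurable]

lemma integral_mul_gammaPi {α : ℝ} (hα : 0 < α) {n : ℕ} {i j : Fin n} (hij : i ≠ j) :
    ∫ X, X i * X j ∂gammaPi α n = α ^ 2 := by
  have := isProbabilityMeasure_gammaMeasure hα one_pos
  have hind : iIndepFun (fun (i : Fin n) (X : Fin n → ℝ) => X i) (gammaPi α n) :=
    iIndepFun_pi (X := fun _ => id) fun _ => aemeasurable_id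
  have h1 := fun i : Fin n => integral_eval_gammaPi hα i (f := fun x => x) measurable_id
  rw [(hind.indepFun hij).integral_fun_mul_eq_mul_integral
    (measurable_pi_apply i).aestronglyMeasurable (measurable_pi_apply j).aestronglyMeasurable, h1, h1,
    integral_id_gammaMeasure hα, sq]

/-- Averaging the Taylor expansion of the gamma distribution function over a nonnegative shift. -/
lemma exists_integral_cdf_gamma_taylor {α : ℝ} (hα : 0 < α) {x : ℝ} (hx : 0 < x) :
    ∃ C, 0 ≤ C ∧ ∀ (n : ℕ) (W : (Fin n → ℝ) → ℝ), Measurable W → (∀ᵐ Y ∂gammaPi α n, 0 ≤ W Y) →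
      MemLp W 3 (gammaPi α n) →
      |∫ Y, cdf (gammaMeasure α 1) (x - W Y) ∂gammaPi α n - (cdf (gammaMeasure α 1) x
        - (Real.Gamma α)⁻¹ * x ^ (α - 1) * Real.exp (-x) * ∫ Y, W Y ∂gammaPi α n
        + (Real.Gamma α)⁻¹ * x ^ (α - 1) * Real.exp (-x) * ((α - 1) / x - 1) / 2
          * ∫ Y, W Y ^ 2 ∂gammaPi α n)| ≤ C * ∫ Y, W Y ^ 3 ∂gammaPi α n := by
  obtain ⟨C, hC⟩ := exists_cdf_gamma_taylor hα hx
  have hC0 : 0 ≤ C := by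
    have := (abs_nonneg _).trans (hC 1 zero_le_one)
    simpa using this
  refine ⟨C, hC0, fun n W hW hpos hL => ?_⟩
  have := isProbabilityMeasure_gammaPi hα n
  set g := (Real.Gamma α)⁻¹ * x ^ (α - 1) * Real.exp (-x)
  set g1 := g * ((α - 1) / x - 1)
  have i1 : Integrable W (gammaPi α n) := hL.integrable (by norm_num)
  have i2 : Integrable (fun Y => W Y ^ 2) (gammaPi α n) :=
    (hL.mono_exponent (by norm_num)).integrable_sq
  have i3 : Integrable (fun Y => W Y ^ 3) (gammaPi α n) := by
    have := hL.integrable_norm_pow (p := 3) (by norm_num)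
    refine this.congr ?_
    filter_upwards [hpos] with Y hY
    simp [abs_of_nonneg hY]
  have i0 : Integrable (fun Y => (cdf (gammaMeasure α 1) (x - W Y) : ℝ)) (gammaPi α n) := by
    refine Integrable.of_bound (C := 1) ?_ (Eventually.of_forall fun Y => ?_)
    · exact ((monotone_cdf _).measurable.comp (measurable_const.sub hW)).aestronglyMeasurable
    · rw [Real.norm_of_nonneg (cdf_nonneg _ _)]
      exact cdf_le_one _ _
  have j1 : Integrable (fun Y => cdf (gammaMeasure α 1) x - g * W Y) (gammaPi α n) :=
    (integrable_const _).sub (i1.const_mul _)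
  have j2 : Integrable (fun Y => cdf (gammaMeasure α 1) x - g * W Y + g1 / 2 * W Y ^ 2)
      (gammaPi α n) := j1.add (i2.const_mul _)
  have key : ∫ Y, (cdf (gammaMeasure α 1) (x - W Y) - (cdf (gammaMeasure α 1) x
        - g * W Y + g1 / 2 * W Y ^ 2)) ∂gammaPi α n
      = ∫ Y, cdf (gammaMeasure α 1) (x - W Y) ∂gammaPi α n - (cdf (gammaMeasure α 1) x
        - g * ∫ Y, W Y ∂gammaPi α n + g1 / 2 * ∫ Y, W Y ^ 2 ∂gammaPi α n) := by
    rw [integral_sub i0 j2, integral_add j1 (i2.const_mul _),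
      integral_sub (integrable_const _) (i1.const_mul _), integral_const_mul, integral_const_mul]
    simp
  rw [← key, ← integral_const_mul]
  refine (abs_integral_le_integral_abs).trans (integral_mono_ae ?_ (i3.const_mul C) ?_)
  · exact (i0.sub j2).abs
  · filter_upwards [hpos] with Y hY using hC _ hY

/-! ### Three sign changes with a zero weight -/

/-- The averaged Taylor expansion for an affine shift with nonnegative coefficients of size at
most `r`, with all moments evaluated. -/
lemma exists_affine_shift_taylor {α : ℝ} (hα : 0 < α) {x : ℝ} (hx : 0 < x) :
    ∃ C, 0 ≤ C ∧ ∀ u v w r : ℝ, 0 ≤ u → 0 ≤ v → 0 ≤ w → u ≤ r → v ≤ r → w ≤ r →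
      |∫ Y, cdf (gammaMeasure α 1) (x - (u + v * Y 0 + w * Y 1)) ∂gammaPi α 2
        - (cdf (gammaMeasure α 1) x
        - (Real.Gamma α)⁻¹ * x ^ (α - 1) * Real.exp (-x) * (u + (v + w) * α)
        + (Real.Gamma α)⁻¹ * x ^ (α - 1) * Real.exp (-x) * ((α - 1) / x - 1) / 2
          * (u ^ 2 + 2 * u * (v + w) * α + (v ^ 2 + w ^ 2) * (α * (α + 1)) + 2 * v * w * α ^ 2))|
        ≤ C * r ^ 3 := by
  obtain ⟨C, hC0, hC⟩ := exists_integral_cdf_gamma_taylor hα hx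
  have := isProbabilityMeasure_gammaPi hα 2
  have hL : ∀ u v w : ℝ, MemLp (fun Y : Fin 2 → ℝ => u + v * Y 0 + w * Y 1) 3 (gammaPi α 2) :=
    fun u v w => ((memLp_const u).add ((memLp_eval_gammaPi hα 0 3).const_mul v)).add
      ((memLp_eval_gammaPi hα 1 3).const_mul w)
  have hcube : ∀ u v w : ℝ, Integrable (fun Y : Fin 2 → ℝ => |u + v * Y 0 + w * Y 1| ^ 3)
      (gammaPi α 2) := fun u v w => (hL u v w).integrable_norm_pow (p := 3) (by norm_num)
  have k1 : ∀ i : Fin 2, Integrable (fun Y : Fin 2 → ℝ => Y i) (gammaPi α 2) :=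
    fun i => (memLp_eval_gammaPi hα i 1).integrable (by norm_num)
  have k2 : ∀ i j : Fin 2, Integrable (fun Y : Fin 2 → ℝ => Y i * Y j) (gammaPi α 2) :=
    fun i j => MemLp.integrable_mul (p := 2) (q := 2) (by simpa using memLp_eval_gammaPi hα i 2)
      (by simpa using memLp_eval_gammaPi hα j 2)
  have m1 : ∀ i : Fin 2, ∫ Y, Y i ∂gammaPi α 2 = α := fun i =>
    (integral_eval_gammaPi hα i (f := fun x => x) measurable_id).trans (integral_id_gammaMeasure hα)
  have m2 : ∀ i : Fin 2, ∫ Y, Y i * Y i ∂gammaPi α 2 = α * (α + 1) := fun i => by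
    simp only [← sq]
    exact (integral_eval_gammaPi hα i (f := fun x => x ^ 2) (by fun_prop)).trans
      (integral_sq_gammaMeasure hα)
  refine ⟨C * ∫ Y, |1 + 1 * Y 0 + 1 * Y 1| ^ 3 ∂gammaPi α 2,
    mul_nonneg hC0 (integral_nonneg fun _ => by positivity), fun u v w r hu hv hw hur hvr hwr => ?_⟩
  have h := hC 2 (fun Y => u + v * Y 0 + w * Y 1) (by fun_prop)
    (by filter_upwards [ae_nonneg_gammaPi hα 2] with Y hY
        have := hY 0; have := hY 1; positivity) (hL u v w)
  have e1 : ∫ Y, (u + v * Y 0 + w * Y 1) ∂gammaPi α 2 = u + (v + w) * α := by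
    have t0 : Integrable (fun _ : Fin 2 → ℝ => u) (gammaPi α 2) := integrable_const _
    have t1 : Integrable (fun Y : Fin 2 → ℝ => u + v * Y 0) (gammaPi α 2) :=
      t0.add ((k1 0).const_mul _)
    rw [integral_add t1 ((k1 1).const_mul _), integral_add t0 ((k1 0).const_mul _),
      integral_const_mul,
      integral_const_mul, m1, m1]
    simp
    ring
  have e2 : ∫ Y, (u + v * Y 0 + w * Y 1) ^ 2 ∂gammaPi α 2 =
      u ^ 2 + 2 * u * (v + w) * α + (v ^ 2 + w ^ 2) * (α * (α + 1)) + 2 * v * w * α ^ 2 := by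
    have hsum : ∀ Y : Fin 2 → ℝ, (u + v * Y 0 + w * Y 1) ^ 2 = u ^ 2 + 2 * u * v * Y 0
        + 2 * u * w * Y 1 + v ^ 2 * (Y 0 * Y 0) + w ^ 2 * (Y 1 * Y 1)
        + 2 * v * w * (Y 0 * Y 1) := fun Y => by ring
    simp only [hsum]
    have t0 : Integrable (fun _ : Fin 2 → ℝ => u ^ 2) (gammaPi α 2) := integrable_const _
    have t1 : Integrable (fun Y : Fin 2 → ℝ => u ^ 2 + 2 * u * v * Y 0) (gammaPi α 2) :=
      t0.add ((k1 0).const_mul _)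
    have t2 : Integrable (fun Y : Fin 2 → ℝ => u ^ 2 + 2 * u * v * Y 0 + 2 * u * w * Y 1)
      (gammaPi α 2) := t1.add ((k1 1).const_mul _)
    have t3 : Integrable (fun Y : Fin 2 → ℝ => u ^ 2 + 2 * u * v * Y 0 + 2 * u * w * Y 1
      + v ^ 2 * (Y 0 * Y 0)) (gammaPi α 2) := t2.add ((k2 0 0).const_mul _)
    have t4 : Integrable (fun Y : Fin 2 → ℝ => u ^ 2 + 2 * u * v * Y 0 + 2 * u * w * Y 1
      + v ^ 2 * (Y 0 * Y 0) + w ^ 2 * (Y 1 * Y 1)) (gammaPi α 2) := t3.add ((k2 1 1).const_mul _)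
    rw [integral_add t4 ((k2 0 1).const_mul _), integral_add t3 ((k2 1 1).const_mul _),
      integral_add t2 ((k2 0 0).const_mul _), integral_add t1 ((k1 1).const_mul _),
      integral_add t0 ((k1 0).const_mul _)]
    simp only [integral_const_mul, m1, m2, integral_mul_gammaPi hα (show (0 : Fin 2) ≠ 1 by decide)]
    simp
    ring
  rw [e1, e2] at h
  refine h.trans ?_
  rw [mul_assoc]
  refine mul_le_mul_of_nonneg_left ?_ hC0
  rw [← integral_mul_const]
  refine integral_mono_of_nonneg ?_ ((hcube 1 1 1).mul_const _) ?_
  · filter_upwards [ae_nonneg_gammaPi hα 2] with Y hY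
    have := hY 0; have := hY 1; simp only [Pi.zero_apply]; positivity
  · filter_upwards [ae_nonneg_gammaPi hα 2] with Y hY
    have h0 := hY 0
    have h1 := hY 1
    have hr : 0 ≤ r := hu.trans hur
    rw [abs_of_nonneg (by positivity), ← mul_pow]
    refine pow_le_pow_left₀ (by positivity) ?_ 3
    nlinarith [mul_le_mul_of_nonneg_right hvr h0, mul_le_mul_of_nonneg_right hwr h1]

/-- The second-order asymptotics of `F_η - F_θ` as `b → 0`, at a fixed point `x`, for
`η = (1, b, b)` and `θ = (1 / (1 - q), 2 b - q / (1 - q), 0)` with `q = K b ^ 2`. Splitting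
`(2 b, 0)` into `(b, b)` contributes `-α` times the derivative of the gamma density, and taking mass
from the first weight contributes a negative multiple of the derivative of `x ^ α * exp (-x)`. -/
lemma tendsto_F_sub_F {α : ℝ} (hα : 0 < α) {K : ℝ} (hK : 0 < K) {x : ℝ} (hx : 0 < x) :
    Tendsto (fun b : ℝ => (F α ![1, b, b] x
        - F α ![1 / (1 - K * b ^ 2), 2 * b - K * b ^ 2 / (1 - K * b ^ 2), 0] x) / b ^ 2)
      (𝓝[>] 0) (𝓝 ((Real.Gamma α)⁻¹ * x ^ (α - 1) * Real.exp (-x)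
        * (α * (1 + (1 - α) / x) - K * (α - x)))) := by
  obtain ⟨C, hC0, hC⟩ := exists_affine_shift_taylor hα hx
  set g := (Real.Gamma α)⁻¹ * x ^ (α - 1) * Real.exp (-x)
  -- `b ^ 2 * P b` is the difference of the two Taylor polynomials with the moments inserted
  set P : ℝ → ℝ := fun b => -g * K * (α - x + 2 * b * α) + g * ((α - 1) / x - 1) / 2 *
    (2 * α * (α + 1) + 2 * α ^ 2 - (K ^ 2 * b ^ 2 * x ^ 2
      + 2 * K * b * x * (2 * (1 - K * b ^ 2) - K * b) * α
      + (2 * (1 - K * b ^ 2) - K * b) ^ 2 * (α * (α + 1)))) with hP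
  have hPlim : Tendsto P (𝓝[>] 0) (𝓝 (g * (α * (1 + (1 - α) / x) - K * (α - x)))) := by
    have : P 0 = g * (α * (1 + (1 - α) / x) - K * (α - x)) := by
      simp only [hP]; ring
    rw [← this]
    exact ((by fun_prop : Continuous P).tendsto 0).mono_left nhdsWithin_le_nhds
  have hbound : ∀ᶠ b in 𝓝[>] (0 : ℝ), |(F α ![1, b, b] x
      - F α ![1 / (1 - K * b ^ 2), 2 * b - K * b ^ 2 / (1 - K * b ^ 2), 0] x) / b ^ 2 - P b|
        ≤ (C + C * (2 + x) ^ 3) * b := by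
    -- `K b < 1 / 2` and `b < 1` keep the second weight of `θ` and the shift `W` nonnegative
    have hδ : 0 < min 1 (1 / (2 * K)) := by positivity
    filter_upwards [Ioo_mem_nhdsGT hδ] with b hb
    have hb0 : 0 < b := hb.1
    have hb1 : b < 1 := hb.2.trans_le (min_le_left _ _)
    have hKb : K * b < 1 / 2 := by
      have := hb.2.trans_le (min_le_right _ _)
      rw [lt_div_iff₀ (by positivity)] at this
      linarith
    have hKb0 : 0 < K * b := by positivity
    have hq : K * b ^ 2 < 1 / 2 := by nlinarith
    have hq' : K * b ^ 2 ≤ b := by nlinarith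
    have hq0 : 0 < K * b ^ 2 := by positivity
    set q := K * b ^ 2 with hqdef
    have Fη : F α ![1, b, b] x
        = ∫ Y, cdf (gammaMeasure α 1) (x - (0 + b * Y 0 + b * Y 1)) ∂gammaPi α 2 := by
      rw [F_succ_eq_integral hα (by simp)]
      simp [Fin.sum_univ_two]
    have Fθ : F α ![1 / (1 - q), 2 * b - q / (1 - q), 0] x
        = ∫ Y, cdf (gammaMeasure α 1) (x - (q * x + (2 * b * (1 - q) - q) * Y 0 + 0 * Y 1))
          ∂gammaPi α 2 := by
      have hq1 : 0 < 1 - q := by linarith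
      rw [F_succ_eq_integral hα (by simpa using hq1)]
      refine integral_congr_ae (Eventually.of_forall fun Y => ?_)
      simp only [Fin.sum_univ_two]
      congr 1
      simp
      field_simp
      ring
    have h1 := hC 0 b b b le_rfl hb0.le hb0.le hb0.le le_rfl le_rfl
    have h2 := hC (q * x) (2 * b * (1 - q) - q) 0 ((2 + x) * b) (by positivity) (by nlinarith)
      le_rfl (by nlinarith) (by nlinarith) (by positivity)
    rw [← Fη] at h1
    rw [← Fθ] at h2
    have hb2 : (0 : ℝ) < b ^ 2 := by positivity
    have : |F α ![1, b, b] x - F α ![1 / (1 - q), 2 * b - q / (1 - q), 0] x - b ^ 2 * P b|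
        ≤ C * b ^ 3 + C * ((2 + x) * b) ^ 3 := by
      refine le_trans (le_of_eq ?_) ((abs_sub _ _).trans (add_le_add h1 h2))
      congr 1
      simp only [hP, hqdef]
      ring
    have e : (F α ![1, b, b] x - F α ![1 / (1 - q), 2 * b - q / (1 - q), 0] x) / b ^ 2 - P b
        = (F α ![1, b, b] x - F α ![1 / (1 - q), 2 * b - q / (1 - q), 0] x - b ^ 2 * P b)
          / b ^ 2 := by field_simp
    rw [e, abs_div, abs_of_pos hb2, div_le_iff₀ hb2]
    refine this.trans (le_of_eq ?_)
    ring
  have hsq : Tendsto (fun b : ℝ => (C + C * (2 + x) ^ 3) * b) (𝓝[>] 0) (𝓝 0) := by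
    have : Continuous fun b : ℝ => (C + C * (2 + x) ^ 3) * b := by fun_prop
    simpa using (this.tendsto 0).mono_left nhdsWithin_le_nhds
  simpa using (squeeze_zero_norm' hbound hsq).add hPlim

lemma F_le_prod {α : ℝ} (hα : 0 < α) {n : ℕ} {θ : Fin n → ℝ} (hθ : ∀ i, 0 < θ i) (x : ℝ) :
    F α θ x ≤ ∏ i, cdf (gammaMeasure α 1) (x / θ i) := by
  have := isProbabilityMeasure_gammaMeasure hα one_pos
  have e : ∏ i, cdf (gammaMeasure α 1) (x / θ i)
      = (gammaPi α n).real (univ.pi fun i => Iic (x / θ i)) := by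
    rw [measureReal_def, Measure.pi_pi, ENNReal.toReal_prod]
    simp [measureReal_def, cdf_eq_real]
  rw [e, F_eq_measureReal hα]
  refine ENNReal.toReal_mono (measure_ne_top _ _) (measure_mono_ae ?_)
  filter_upwards [ae_nonneg_gammaPi hα n] with X hX (h : ∑ i, θ i * X i ≤ x)
  intro i _
  rw [mem_Iic, le_div_iff₀ (hθ i), mul_comm]
  exact (Finset.single_le_sum (f := fun i => θ i * X i)
    (fun j _ => mul_nonneg (hθ j).le (hX j)) (Finset.mem_univ i)).trans h

lemma mul_cdf_le_F {α : ℝ} (hα : 0 < α) {s t : ℝ} (hs : 0 < s) (ht : 0 < t) (x : ℝ) :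
    cdf (gammaMeasure α 1) (x / (2 * s)) * cdf (gammaMeasure α 1) (x / (2 * t))
      ≤ F α ![s, t, 0] x := by
  have := isProbabilityMeasure_gammaMeasure hα one_pos
  have e : cdf (gammaMeasure α 1) (x / (2 * s)) * cdf (gammaMeasure α 1) (x / (2 * t))
      = (gammaPi α 3).real (univ.pi ![Iic (x / (2 * s)), Iic (x / (2 * t)), univ]) := by
    simp [measureReal_def, Measure.pi_pi, Fin.prod_univ_three, cdf_eq_real]
  rw [e, F_eq_measureReal hα]
  refine measureReal_mono fun X hX => ?_
  have h0 : X 0 ≤ x / (2 * s) := hX 0 (mem_univ _)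
  have h1 : X 1 ≤ x / (2 * t) := hX 1 (mem_univ _)
  rw [le_div_iff₀ (by positivity)] at h0 h1
  simp only [mem_ofPred_eq, Fin.sum_univ_three]
  simp
  linarith

/-- Near `0` the three-term sum, of order `x ^ (3 α)`, is below the two-term sum, of order
`x ^ (2 α)`. -/
lemma eventually_F_lt_F {α : ℝ} (hα : 0 < α) {b s t : ℝ} (hb : 0 < b) (hs : 0 < s) (ht : 0 < t) :
    ∀ᶠ x in 𝓝[>] (0 : ℝ), F α ![1, b, b] x < F α ![s, t, 0] x := by
  have hΓ := Real.Gamma_pos_of_pos hα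
  set κ := (Real.Gamma α)⁻¹ / α with hκ
  have hκ0 : 0 < κ := by positivity
  have hlim : Tendsto (fun x : ℝ => κ ^ 3 / (b ^ α * b ^ α) * x ^ α) (𝓝[>] 0) (𝓝 0) := by
    have : ContinuousAt (fun x : ℝ => κ ^ 3 / (b ^ α * b ^ α) * x ^ α) 0 :=
      continuousAt_const.mul (Real.continuousAt_rpow_const _ _ (Or.inr hα.le))
    simpa [ContinuousAt, Real.zero_rpow hα.ne'] using this.mono_left nhdsWithin_le_nhds
  set B := κ ^ 2 * Real.exp (-1) ^ 2 / ((2 * s) ^ α * (2 * t) ^ α) with hB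
  have hB0 : 0 < B := by positivity
  have hδ : 0 < min (2 * s) (2 * t) := by positivity
  filter_upwards [hlim.eventually_lt_const hB0, Ioo_mem_nhdsGT hδ] with x hxB hx
  have hx0 : 0 < x := hx.1
  have hxα : 0 < x ^ α := Real.rpow_pos_of_pos hx0 α
  have up : ∀ c : ℝ, 0 < c → cdf (gammaMeasure α 1) (x / c) ≤ κ * (x ^ α / c ^ α) := fun c hc => by
    refine (cdf_gamma_le hα (div_pos hx0 hc)).trans (le_of_eq ?_)
    rw [Real.div_rpow hx0.le hc.le, hκ]; ring
  have low : ∀ c : ℝ, 0 < c → x ≤ c →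
      κ * (x ^ α / c ^ α) * Real.exp (-1) ≤ cdf (gammaMeasure α 1) (x / c) := fun c hc hxc => by
    refine le_trans (le_of_eq ?_) (le_cdf_gamma hα (div_pos hx0 hc) ((div_le_one hc).2 hxc))
    rw [Real.div_rpow hx0.le hc.le, hκ]; ring
  have hbpos : ∀ i, 0 < ![1, b, b] i := by
    intro i; fin_cases i <;> simp [hb]
  have u1 := up 1 one_pos
  have ub := up b hb
  have l1 := low (2 * s) (by positivity) (hx.2.le.trans (min_le_left _ _))
  have l2 := low (2 * t) (by positivity) (hx.2.le.trans (min_le_right _ _))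
  have c1 := cdf_nonneg (gammaMeasure α 1) (x / 1)
  have cb := cdf_nonneg (gammaMeasure α 1) (x / b)
  calc F α ![1, b, b] x
      ≤ cdf (gammaMeasure α 1) (x / 1) * cdf (gammaMeasure α 1) (x / b)
        * cdf (gammaMeasure α 1) (x / b) := by
        simpa [Fin.prod_univ_three] using F_le_prod hα hbpos x
    _ ≤ κ * (x ^ α / 1 ^ α) * (κ * (x ^ α / b ^ α)) * (κ * (x ^ α / b ^ α)) := by gcongr
    _ = κ ^ 3 / (b ^ α * b ^ α) * x ^ α * (x ^ α) ^ 2 := by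
        rw [Real.one_rpow]; field_simp
    _ < B * (x ^ α) ^ 2 := by gcongr
    _ = κ * (x ^ α / (2 * s) ^ α) * Real.exp (-1) * (κ * (x ^ α / (2 * t) ^ α) * Real.exp (-1)) := by
        rw [hB]; field_simp
    _ ≤ cdf (gammaMeasure α 1) (x / (2 * s)) * cdf (gammaMeasure α 1) (x / (2 * t)) := by
        refine mul_le_mul l1 l2 (by positivity) (cdf_nonneg _ _)
    _ ≤ F α ![s, t, 0] x := mul_cdf_le_F hα hs ht x

lemma changesSignAtLeast_three_of_points {f : ℝ → ℝ} {a b c d : ℝ} (ha : 0 < a) (hab : a < b)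
    (hbc : b < c) (hcd : c < d) (fa : f a < 0) (fb : 0 < f b) (fc : f c < 0) (fd : 0 < f d) :
    ChangesSignAtLeast 3 f := by
  refine ⟨![a, b, c, d], Fin.strictMono_iff_lt_succ.2 fun i => ?_, fun i => ?_, fun i => ?_,
    fun i => ?_⟩
  · fin_cases i <;> simp [hab, hbc, hcd]
  · fin_cases i <;> simp <;> linarith
  · fin_cases i <;> simp [fa.ne, fb.ne', fc.ne, fd.ne']
  · fin_cases i
    · simpa using mul_neg_of_neg_of_pos fa fb
    · simpa using mul_neg_of_pos_of_neg fb fc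
    · simpa using mul_neg_of_neg_of_pos fc fd

/-- The signs `-, +, -, +` occur near `0`, at `α (1 - α) / 4`, at `α / 2` and at `2 α`. This is
where `α < 1` enters: the gamma density is decreasing, and its derivative dominates near `0`. -/
lemma exists_three_sign_changes_boundary {α : ℝ} (hα0 : 0 < α) (hα1 : α < 1) :
    ∃ b s t : ℝ, 0 < b ∧ b < 1 ∧ 1 < s ∧ 0 < t ∧ t < 1 ∧ s + t = 1 + b + b ∧
      ChangesSignAtLeast 3 fun x => F α ![1, b, b] x - F α ![s, t, 0] x := by
  -- the limit is negative at `α / 2` iff `K > 4 / α - 2`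
  set K := 4 / α with hK
  have hK0 : 0 < K := by positivity
  have hx1 : 0 < α * (1 - α) / 4 := by
    have : 0 < 1 - α := by linarith
    positivity
  have hg : ∀ x : ℝ, 0 < x → 0 < (Real.Gamma α)⁻¹ * x ^ (α - 1) * Real.exp (-x) := fun x hx => by
    have := Real.Gamma_pos_of_pos hα0
    positivity
  have L1 := tendsto_F_sub_F hα0 hK0 hx1
  have L2 := tendsto_F_sub_F hα0 hK0 (x := α / 2) (by positivity)
  have L3 := tendsto_F_sub_F hα0 hK0 (x := 2 * α) (by positivity)
  have s1 : 0 < α * (1 + (1 - α) / (α * (1 - α) / 4)) - K * (α - α * (1 - α) / 4) := by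
    have : (1 - α) ≠ 0 := by linarith
    rw [show α * (1 + (1 - α) / (α * (1 - α) / 4)) - K * (α - α * (1 - α) / 4) = α + (1 - α) by
      rw [hK]; field_simp; ring]
    linarith
  have s2 : α * (1 + (1 - α) / (α / 2)) - K * (α - α / 2) < 0 := by
    rw [show α * (1 + (1 - α) / (α / 2)) - K * (α - α / 2) = -α by rw [hK]; field_simp; ring]
    linarith
  have s3 : 0 < α * (1 + (1 - α) / (2 * α)) - K * (α - 2 * α) := by
    rw [show α * (1 + (1 - α) / (2 * α)) - K * (α - 2 * α) = α / 2 + 9 / 2 by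
      rw [hK]; field_simp; ring]
    linarith
  have E1 := L1.eventually_const_lt (mul_pos (hg _ hx1) s1)
  have E2 := L2.eventually_lt_const (mul_neg_of_pos_of_neg (hg _ (by positivity)) s2)
  have E3 := L3.eventually_const_lt (mul_pos (hg _ (by positivity)) s3)
  have hδ : 0 < min (1 / 4) (1 / (4 * K)) := by positivity
  obtain ⟨b, e1, e2, e3, hb⟩ := (E1.and (E2.and (E3.and (Ioo_mem_nhdsGT hδ)))).exists
  have hb0 : 0 < b := hb.1
  have hb1 : b < 1 / 4 := hb.2.trans_le (min_le_left _ _)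
  have hKb : K * b < 1 / 4 := by
    have := hb.2.trans_le (min_le_right _ _)
    rw [lt_div_iff₀ (by positivity)] at this
    linarith
  have hb2 : 0 < b ^ 2 := by positivity
  have hq0 : 0 < K * b ^ 2 := by positivity
  have hqb : K * b ^ 2 < b / 4 := by nlinarith
  set q := K * b ^ 2
  have hq1 : 0 < 1 - q := by linarith
  have hs : 1 < 1 / (1 - q) := by rw [lt_div_iff₀ hq1]; linarith
  have hqq0 : 0 < q / (1 - q) := by positivity
  have hqq : q / (1 - q) < b := by rw [div_lt_iff₀ hq1]; nlinarith
  obtain ⟨a, ea, ha⟩ := ((eventually_F_lt_F hα0 hb0 (zero_lt_one.trans hs)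
    (by linarith : 0 < 2 * b - q / (1 - q))).and (Ioo_mem_nhdsGT hx1)).exists
  refine ⟨b, 1 / (1 - q), 2 * b - q / (1 - q), hb0, by linarith, hs, by linarith, by linarith, ?_,
    changesSignAtLeast_three_of_points ha.1 ha.2 (c := α / 2) (d := 2 * α) (by nlinarith)
      (by linarith) (sub_neg.2 ea) ?_ ?_ ?_⟩
  · field_simp; ring
  · exact (div_pos_iff_of_pos_right hb2).1 e1
  · exact (div_neg_iff.1 e2).resolve_left (fun h => absurd h.2 hb2.not_gt) |>.1
  · exact (div_pos_iff_of_pos_right hb2).1 e3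

/-! ### Majorization and stability under small perturbations -/

lemma decr_eq_of_antitone {n : ℕ} {θ : Fin n → ℝ} {σ : Equiv.Perm (Fin n)}
    (h : Antitone (θ ∘ σ)) : decr θ = θ ∘ σ := by
  have hanti : Antitone (θ ∘ (Fin.revPerm.trans (Tuple.sort θ))) := fun i j hij =>
    Tuple.monotone_sort θ (Fin.rev_le_rev.2 hij)
  exact Tuple.unique_antitone hanti h

lemma exists_antitone_perm {n : ℕ} (θ : Fin n → ℝ) :
    ∃ σ : Equiv.Perm (Fin n), Antitone (θ ∘ σ) :=
  ⟨Fin.revPerm.trans (Tuple.sort θ), fun _ _ hij =>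
    Tuple.monotone_sort θ (Fin.rev_le_rev.2 hij)⟩

lemma antitone_append {n m : ℕ} {f : Fin n → ℝ} {g : Fin m → ℝ} (hf : Antitone f)
    (hg : Antitone g) (hfg : ∀ i j, g j ≤ f i) : Antitone (Fin.append f g) := by
  intro i j
  refine Fin.addCases (fun i => ?_) (fun i => ?_) i <;>
    refine Fin.addCases (fun j => ?_) (fun j => ?_) j <;> intro hij
  · simpa using hf (Fin.le_def.2 (Fin.le_def.1 hij))
  · simpa using hfg i j
  · exact absurd hij (not_le.2 (by rw [Fin.lt_def]; simp; omega))
  · simpa using hg (by simpa using hij)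

/-- Appending entries below all others commutes with sorting. -/
lemma decr_append {n m : ℕ} {θ : Fin n → ℝ} {c : Fin m → ℝ} (h : ∀ i j, c j ≤ θ i) :
    decr (Fin.append θ c) = Fin.append (decr θ) (decr c) := by
  obtain ⟨σ, hσ⟩ := exists_antitone_perm θ
  obtain ⟨τ, hτ⟩ := exists_antitone_perm c
  have e : Fin.append θ c ∘ finSumFinEquiv.permCongr (Equiv.sumCongr σ τ)
      = Fin.append (θ ∘ σ) (c ∘ τ) := by
    ext i
    refine Fin.addCases (fun i => ?_) (fun i => ?_) i <;> simp [Equiv.permCongr_apply]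
  rw [decr_eq_of_antitone hσ, decr_eq_of_antitone hτ, ← e]
  refine decr_eq_of_antitone ?_
  rw [e]
  exact antitone_append hσ hτ fun i j => h (σ i) (τ j)

lemma sum_decr {n : ℕ} (θ : Fin n → ℝ) : ∑ i, decr θ i = ∑ i, θ i :=
  Equiv.sum_comp (Fin.revPerm.trans (Tuple.sort θ)) θ

/-- Stated for appended entries below all others, where the `k` largest entries are those of the
original vector, followed by appended ones that agree on both sides. -/
lemma MajorizedBy.append {n m : ℕ} {η θ : Fin n → ℝ} (h : MajorizedBy η θ) {c : Fin m → ℝ}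
    (hη : ∀ i j, c j ≤ η i) (hθ : ∀ i j, c j ≤ θ i) :
    MajorizedBy (Fin.append η c) (Fin.append θ c) := by
  refine ⟨fun k _ => ?_, by simp [Fin.sum_univ_add, h.2]⟩
  rw [decr_append hη, decr_append hθ]
  simp only [Finset.sum_filter, Fin.sum_univ_add, Fin.append_left, Fin.append_right,
    Fin.val_castAdd]
  refine add_le_add_left ?_ _
  rcases le_total k n with hk | hk
  · simpa only [Finset.sum_filter] using h.1 k hk
  · have hlt : ∀ i : Fin n, i.val < k := fun i => i.isLt.trans_le hk
    simp only [hlt, if_true, sum_decr]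
    exact h.2.le

lemma ChangesSignAtLeast.eventually {ι : Type*} {l : Filter ι} {f : ι → ℝ → ℝ} {g : ℝ → ℝ}
    {k : ℕ} (hg : ChangesSignAtLeast k g) (hf : ∀ x, Tendsto (fun i => f i x) l (𝓝 (g x))) :
    ∀ᶠ i in l, ChangesSignAtLeast k (f i) := by
  obtain ⟨x, hx, hpos, hne, hsign⟩ := hg
  have h1 : ∀ᶠ i in l, ∀ j, f i (x j) ≠ 0 :=
    eventually_all.2 fun j => (hf (x j)).eventually_ne (hne j)
  have h2 : ∀ᶠ i in l, ∀ j : Fin k, f i (x j.castSucc) * f i (x j.succ) < 0 :=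
    eventually_all.2 fun j => ((hf _).mul (hf _)).eventually_lt_const (hsign j)
  filter_upwards [h1, h2] with i a b using ⟨x, hx, hpos, a, b⟩

lemma ChangesSignAtLeast.of_succ {k : ℕ} {f : ℝ → ℝ} (h : ChangesSignAtLeast (k + 1) f) :
    ChangesSignAtLeast k f := by
  obtain ⟨x, hx, hpos, hne, hsign⟩ := h
  exact ⟨fun i => x i.castSucc, fun i j hij => hx (Fin.castSucc_lt_castSucc_iff.2 hij),
    fun i => hpos _, fun i => hne _, fun i => hsign i.castSucc⟩

lemma tendsto_F_append {α : ℝ} (hα : 0 < α) {n m : ℕ} {θ : Fin n → ℝ} {i : Fin n}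
    (hi : θ i ≠ 0) (x : ℝ) :
    Tendsto (fun c : Fin m → ℝ => F α (Fin.append θ c) x) (𝓝 0) (𝓝 (F α θ x)) := by
  have hcont : Continuous fun c : Fin m → ℝ => Fin.append θ c := by
    refine continuous_pi fun j => ?_
    refine Fin.addCases (fun j => ?_) (fun j => ?_) j
    · simpa using continuous_const
    · simpa using continuous_apply j
  have hF := continuousAt_F hα (θ := Fin.append θ (0 : Fin m → ℝ)) (i := Fin.castAdd m i)
    (by simpa using hi) x
  rw [← F_append_zero hα θ x (m := m)]
  exact hF.tendsto.comp (hcont.tendsto 0)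

/-- The pair with a zero weight is moved into the open orthant by adding one small constant to all
weights, which preserves majorization. -/
lemma exists_three_sign_changes {α : ℝ} (hα0 : 0 < α) (hα1 : α < 1) :
    ∃ θ η : Fin 3 → ℝ, (∀ i, 0 < θ i) ∧ (∀ i, 0 < η i) ∧ MajorizedBy η θ ∧
      ChangesSignAtLeast 3 fun x => F α η x - F α θ x := by
  obtain ⟨b, s, t, hb0, hb1, hs, ht0, ht1, hsum, hsign⟩ :=
    exists_three_sign_changes_boundary hα0 hα1
  have hlim : ∀ θ : Fin 3 → ℝ, θ 0 ≠ 0 → ∀ x,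
      Tendsto (fun δ : ℝ => F α (fun i => θ i + δ) x) (𝓝[>] 0) (𝓝 (F α θ x)) := by
    intro θ hθ x
    have hc : Tendsto (fun (δ : ℝ) (i : Fin 3) => θ i + δ) (𝓝 0) (𝓝 θ) := by
      have : Continuous fun (δ : ℝ) (i : Fin 3) => θ i + δ := by fun_prop
      simpa using this.tendsto 0
    exact ((continuousAt_F hα0 hθ x).tendsto.comp hc).mono_left nhdsWithin_le_nhds
  have hev := hsign.eventually (l := 𝓝[>] (0 : ℝ)) fun x =>
    (hlim ![1, b, b] (by simp) x).sub (hlim ![s, t, 0] (by simp; linarith) x)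
  obtain ⟨δ, hδ, hδ0⟩ := (hev.and self_mem_nhdsWithin).exists
  replace hδ0 : 0 < δ := hδ0
  have aη : Antitone (fun i => ![1, b, b] i + δ) := by
    refine Fin.antitone_iff_succ_le.2 fun i => ?_
    fin_cases i <;> simp [hb1.le]
  have aθ : Antitone (fun i => ![s, t, 0] i + δ) := by
    refine Fin.antitone_iff_succ_le.2 fun i => ?_
    fin_cases i <;> simp <;> linarith
  refine ⟨fun i => ![s, t, 0] i + δ, fun i => ![1, b, b] i + δ, fun i => ?_, fun i => ?_,
    ⟨fun k hk => ?_, ?_⟩, hδ⟩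
  · fin_cases i <;> simp <;> linarith
  · fin_cases i <;> simp <;> linarith
  · rw [decr_eq_of_antitone (σ := 1) aη, decr_eq_of_antitone (σ := 1) aθ]
    interval_cases k <;> simp [Finset.sum_filter, Fin.sum_univ_three] <;> linarith
  · simp [Fin.sum_univ_three]
    linarith

lemma exists_eps_append {α : ℝ} (hα : 0 < α) {θ η : Fin 3 → ℝ} (hθ : ∀ i, 0 < θ i)
    (hη : ∀ i, 0 < η i) (hmaj : MajorizedBy η θ)
    (hsign : ChangesSignAtLeast 3 fun x => F α η x - F α θ x) (m : ℕ) :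
    ∃ ε : ℝ, 0 < ε ∧ ∀ c : Fin m → ℝ, (∀ i, 0 < c i ∧ c i < ε) →
      MajorizedBy (Fin.append η c) (Fin.append θ c) ∧
      ChangesSignAtLeast 3 fun x => F α (Fin.append η c) x - F α (Fin.append θ c) x := by
  have hev := hsign.eventually (l := 𝓝 (0 : Fin m → ℝ)) fun x =>
    (tendsto_F_append hα (hη 0).ne' x).sub (tendsto_F_append hα (hθ 0).ne' x)
  obtain ⟨r, hr, hball⟩ := Metric.eventually_nhds_iff.1 hev
  have hsmall : ∀ᶠ ε in 𝓝[>] (0 : ℝ), ∀ i, ε < θ i ∧ ε < η i :=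
    eventually_all.2 fun i => nhdsWithin_le_nhds
      ((eventually_lt_nhds (hθ i)).and (eventually_lt_nhds (hη i)))
  obtain ⟨ε, hε, hε0, hεr⟩ := (hsmall.and (Ioo_mem_nhdsGT hr)).exists
  refine ⟨ε, hε0, fun c hc => ⟨hmaj.append (fun i j => ?_) fun i j => ?_, hball ?_⟩⟩
  · exact ((hc j).2.trans (hε i).2).le
  · exact ((hc j).2.trans (hε i).1).le
  · refine (dist_pi_lt_iff hr).2 fun i => ?_
    rw [Pi.zero_apply, Real.dist_eq, sub_zero, abs_of_pos (hc i).1]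
    exact (hc i).2.trans hεr

end UniqueCrossing

theorem theorem2 (α : ℝ) (hα0 : 0 < α) (hα1 : α < 1) :
    (∃ θ η : Fin 3 → ℝ, (∀ i, 0 < θ i) ∧ (∀ i, 0 < η i) ∧ UniqueCrossing.MajorizedBy η θ ∧
      UniqueCrossing.ChangesSignAtLeast 3
        fun x => UniqueCrossing.F α η x - UniqueCrossing.F α θ x) ∧
    (∀ θ η : Fin 3 → ℝ, (∀ i, 0 < θ i) → (∀ i, 0 < η i) → UniqueCrossing.MajorizedBy η θ →
      (UniqueCrossing.ChangesSignAtLeast 3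
        fun x => UniqueCrossing.F α η x - UniqueCrossing.F α θ x) →
      ∀ m : ℕ, ∃ ε : ℝ, 0 < ε ∧ ∀ c : Fin m → ℝ, (∀ i, 0 < c i ∧ c i < ε) →
        UniqueCrossing.MajorizedBy (Fin.append η c) (Fin.append θ c) ∧
        UniqueCrossing.ChangesSignAtLeast 3 fun x =>
          UniqueCrossing.F α (Fin.append η c) x - UniqueCrossing.F α (Fin.append θ c) x) ∧
    (∀ n : ℕ, 3 ≤ n → ¬ UniqueCrossing.UCC α n) := by
  refine ⟨UniqueCrossing.exists_three_sign_changes hα0 hα1,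
    fun θ η hθ hη hmaj hsign m => UniqueCrossing.exists_eps_append hα0 hθ hη hmaj hsign m,
    fun n hn hucc => ?_⟩
  obtain ⟨m, rfl⟩ := Nat.exists_eq_add_of_le hn
  obtain ⟨θ, η, hθ, hη, hmaj, hsign⟩ := UniqueCrossing.exists_three_sign_changes hα0 hα1
  obtain ⟨ε, hε, hc⟩ := UniqueCrossing.exists_eps_append hα0 hθ hη hmaj hsign m
  obtain ⟨hmaj', hsign'⟩ := hc (fun _ => ε / 2) fun _ => ⟨by positivity, by linarith⟩
  have hnonneg : ∀ ζ : Fin 3 → ℝ, (∀ i, 0 < ζ i) →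
      ∀ i, 0 ≤ Fin.append ζ (fun _ : Fin m => ε / 2) i := by
    intro ζ hζ i
    refine Fin.addCases (fun i => ?_) (fun i => ?_) i
    · simpa using (hζ i).le
    · simpa using (half_pos hε).le
  refine (hucc _ _ (hnonneg θ hθ) (hnonneg η hη) hmaj' ?_).2.1 hsign'.of_succ
  rintro ⟨σ, hσ⟩
  obtain ⟨x, -, -, hne, -⟩ := hsign'
  refine hne 0 ?_
  simp only [hσ, UniqueCrossing.F_comp_perm hα0, sub_self]
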